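/- Let $d\ge 1$ and $k\ge 0$ be integers, let $\Omega\subset\mathbb{R}^d$ be a non-empty open set, and let $\lambda$ denote Lebesgue measure. Let $W^{k,1}(\Omega)$ be the Sobolev space of all real-valued $u\in L^1(\Omega)$ whose weak derivatives $D^\alpha u$ exist and belong to $L^1(\Omega)$ for all multi-indices $\alpha\in\mathbb{N}^d$ with $|\alpha|\le k$, with the norm $\|u\|_{W^{k,1}(\Omega)}=\sum_{|\alpha|\le k}\int_\Omega|D^\alpha u|\,\mathrm{d}\lambda$ (so $W^{0,1}(\Omega)=L^1(\Omega)$). Let $\mathcal{F}\subset W^{k,1}(\Omega)$. Then the following are equivalent. 1. The following three conditions hold: (a) there is a constant $M>0$ such that $\|f\|_{W^{k,1}(\Omega)}\le M$ for every $f\in\mathcal{F}$; (b) there is a function $\delta\colon(0,\infty)\to(0,\infty)$ such that for every $f\in\mathcal{F}$, every $\varepsilon>0$ and every measurable $A\subset\Omega$ with $\lambda(A)<\delta(\varepsilon)$, $$\sum_{|\alpha|\le k}\int_A|D^\alpha f|\,\mathrm{d}\lambda<\varepsilon;$$ (c) there is a map $\omega\colon(0,\infty)\to 2^{\Omega}$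 such that every $\omega(\varepsilon)$ is measurable with $\lambda(\omega(\varepsilon))<\infty$, and for every $f\in\mathcal{F}$ and every $\varepsilon>0$, $$\sum_{|\alpha|\le k}\int_{\Omega\setminus\omega(\varepsilon)}|D^\alpha f|\,\mathrm{d}\lambda<\varepsilon.$$ 2. $\mathcal{F}$ is relatively weakly compact in $W^{k,1}(\Omega)$, that is, the closure of $\mathcal{F}$ in the weak topology $\sigma\bigl(W^{k,1}(\Omega),W^{k,1}(\Omega)^\star\bigr)$ is compact in that topology. -/

import Mathlib

open MeasureTheory TopologicalSpace Distributions LineDeriv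

noncomputable section

/-- The multi-indices `α ∈ ℕ^d` of length `|α| = α₁ + ⋯ + α_d ≤ k`. -/
def multiIndices (d k : ℕ) : Finset (Fin d → ℕ) :=
  (Fintype.piFinset fun _ => Finset.range (k + 1)).filter fun α => ∑ i, α i ≤ k

theorem mem_multiIndices {d k : ℕ} {α : Fin d → ℕ} :
    α ∈ multiIndices d k ↔ ∑ i, α i ≤ k := by
  simp only [multiIndices, Finset.mem_filter, Fintype.mem_piFinset, Finset.mem_range,
    and_iff_right_iff_imp]
  intro h i
  have := Finset.single_le_sum (f := α) (fun j _ => Nat.zero_le _) (Finset.mem_univ i)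
  omega

/-- The classical partial derivative `D^α φ = ∂₁^{α₁} ⋯ ∂_d^{α_d} φ` of a test function
`φ ∈ C_c^∞(Ω)`. -/
def testDeriv {d : ℕ} {Ω : Opens (EuclideanSpace ℝ (Fin d))} (α : Fin d → ℕ)
    (φ : 𝓓(Ω, ℝ)) : 𝓓(Ω, ℝ) :=
  (List.finRange d).foldr (fun i ψ => (∂_{EuclideanSpace.single i (1 : ℝ)})^[α i] ψ) φ

/-- `v` is an `α`-th weak derivative of `u` on `Ω`:
`∫_Ω u D^α φ = (-1)^{|α|} ∫_Ω v φ` for every `φ ∈ C_c^∞(Ω)`. -/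
def IsWeakDeriv {d : ℕ} (Ω : Opens (EuclideanSpace ℝ (Fin d))) (α : Fin d → ℕ)
    (u v : EuclideanSpace ℝ (Fin d) → ℝ) : Prop :=
  ∀ φ : 𝓓(Ω, ℝ), ∫ x in Ω, u x * testDeriv α φ x = (-1) ^ (∑ i, α i) * ∫ x in Ω, v x * φ x

/-- The Lebesgue space `L¹(Ω)` of (classes of) real-valued functions. -/
abbrev L1Space {d : ℕ} (Ω : Opens (EuclideanSpace ℝ (Fin d))) : Type :=
  Lp ℝ 1 (volume.restrict (Ω : Set (EuclideanSpace ℝ (Fin d))))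

section basic

variable {d : ℕ} {Ω : Opens (EuclideanSpace ℝ (Fin d))} {α : Fin d → ℕ}

theorem testDeriv_zero (φ : 𝓓(Ω, ℝ)) : testDeriv 0 φ = φ := by
  unfold testDeriv
  induction List.finRange d with
  | nil => rfl
  | cons i l _ => simp

theorem L1Space.integrable_mul_test (u : L1Space Ω) (φ : 𝓓(Ω, ℝ)) :
    Integrable (fun x => u x * φ x) (volume.restrict (Ω : Set (EuclideanSpace ℝ (Fin d)))) := by
  have hu := L1.integrable_coeFn u
  obtain ⟨C, hC⟩ := φ.continuous.bounded_above_of_compact_support φ.hasCompactSupport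
  exact hu.mul_bdd (c := C) φ.aestronglyMeasurable (Filter.Eventually.of_forall hC)

theorem IsWeakDeriv.zero : IsWeakDeriv Ω α (0 : L1Space Ω) (0 : L1Space Ω) := by
  intro φ
  have h : ∀ ψ : 𝓓(Ω, ℝ), ∫ x in Ω, (0 : L1Space Ω) x * ψ x = 0 := fun ψ => by
    rw [integral_congr_ae (g := fun _ => (0 : ℝ)), integral_zero]
    filter_upwards [Lp.coeFn_zero ℝ 1
      (volume.restrict (Ω : Set (EuclideanSpace ℝ (Fin d))))] with x hx
    rw [hx, Pi.zero_apply, zero_mul]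
  rw [h, h, mul_zero]

theorem IsWeakDeriv.add {u₁ u₂ v₁ v₂ : L1Space Ω} (h₁ : IsWeakDeriv Ω α u₁ v₁)
    (h₂ : IsWeakDeriv Ω α u₂ v₂) :
    IsWeakDeriv Ω α (u₁ + u₂ : L1Space Ω) (v₁ + v₂ : L1Space Ω) := by
  intro φ
  have h : ∀ (a b : L1Space Ω) (ψ : 𝓓(Ω, ℝ)), ∫ x in Ω, (a + b : L1Space Ω) x * ψ x
      = (∫ x in Ω, a x * ψ x) + ∫ x in Ω, b x * ψ x := fun a b ψ => by
    rw [← integral_add (a.integrable_mul_test ψ) (b.integrable_mul_test ψ)]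
    refine integral_congr_ae ?_
    filter_upwards [Lp.coeFn_add a b] with x hx
    rw [hx, Pi.add_apply, add_mul]
  rw [h, h, h₁ φ, h₂ φ, mul_add]

theorem IsWeakDeriv.smul (c : ℝ) {u v : L1Space Ω} (h₁ : IsWeakDeriv Ω α u v) :
    IsWeakDeriv Ω α (c • u : L1Space Ω) (c • v : L1Space Ω) := by
  intro φ
  have h : ∀ (a : L1Space Ω) (ψ : 𝓓(Ω, ℝ)), ∫ x in Ω, (c • a : L1Space Ω) x * ψ x
      = c * ∫ x in Ω, a x * ψ x := fun a ψ => by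
    rw [← integral_const_mul]
    refine integral_congr_ae ?_
    filter_upwards [Lp.coeFn_smul c a] with x hx
    rw [hx, Pi.smul_apply, smul_eq_mul, mul_assoc]
  rw [h, h, h₁ φ]
  ring

theorem IsWeakDeriv.unique {u v w : L1Space Ω} (h₁ : IsWeakDeriv Ω α u v)
    (h₂ : IsWeakDeriv Ω α u w) : v = w := by
  have hv := L1.integrable_coeFn v
  have hw := L1.integrable_coeFn w
  have key := Ω.isOpen.ae_eq_zero_of_integral_contDiff_smul_eq_zero (μ := volume)
    (f := fun x => v x - w x) (IntegrableOn.locallyIntegrableOn (hv.sub hw)) (by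
      intro g hg hgc hgs
      let φ : 𝓓(Ω, ℝ) := ⟨g, hg, hgc, hgs⟩
      have e : ∫ x in Ω, v x * φ x = ∫ x in Ω, w x * φ x :=
        mul_left_cancel₀ (pow_ne_zero _ (by norm_num)) ((h₁ φ).symm.trans (h₂ φ))
      rw [← setIntegral_eq_integral_of_forall_compl_eq_zero
        (s := (Ω : Set (EuclideanSpace ℝ (Fin d))))]
      · rw [← sub_eq_zero, ← integral_sub (v.integrable_mul_test φ)
          (w.integrable_mul_test φ)] at e
        rw [← e]
        refine integral_congr_ae (Filter.Eventually.of_forall fun x => ?_)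
        change g x • (v x - w x) = v x * g x - w x * g x
        simp only [smul_eq_mul]
        ring
      · intro x hx
        have : g x = 0 := image_eq_zero_of_notMem_tsupport fun h => hx (hgs h)
        simp [this])
  refine Lp.ext ?_
  filter_upwards [(ae_restrict_iff' Ω.isOpen.measurableSet).2 key] with x hx
  exact sub_eq_zero.1 hx

end basic

/-- The set of all `u ∈ L¹(Ω)` that have a weak derivative of order `α` in `L¹(Ω)` for every
multi-index `α` with `|α| ≤ k`, as a linear subspace of `L¹(Ω)`. -/
def sobolevSubmodule {d : ℕ} (Ω : Opens (EuclideanSpace ℝ (Fin d))) (k : ℕ) :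
    Submodule ℝ (L1Space Ω) where
  carrier := {u | ∀ α ∈ multiIndices d k, ∃ v : L1Space Ω, IsWeakDeriv Ω α u v}
  zero_mem' := fun _ _ => ⟨0, .zero⟩
  add_mem' := fun h₁ h₂ α hα => by
    obtain ⟨v₁, hv₁⟩ := h₁ α hα
    obtain ⟨v₂, hv₂⟩ := h₂ α hα
    exact ⟨v₁ + v₂, hv₁.add hv₂⟩
  smul_mem' := fun c _ h₁ α hα => by
    obtain ⟨v, hv⟩ := h₁ α hα
    exact ⟨c • v, hv.smul c⟩

/-- The Sobolev space `W^{k,1}(Ω)`. It is a type of its own, since it carries the norm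
`∑_{|α| ≤ k} ‖D^α u‖_{L¹(Ω)}` and not the one inherited from `L¹(Ω)`. -/
def SobolevW1 {d : ℕ} (Ω : Opens (EuclideanSpace ℝ (Fin d))) (k : ℕ) : Type :=
  ↥(sobolevSubmodule Ω k)

namespace SobolevW1

variable {d : ℕ} {Ω : Opens (EuclideanSpace ℝ (Fin d))} {k : ℕ}

instance : AddCommGroup (SobolevW1 Ω k) :=
  inferInstanceAs (AddCommGroup ↥(sobolevSubmodule Ω k))

instance : Module ℝ (SobolevW1 Ω k) :=
  inferInstanceAs (Module ℝ ↥(sobolevSubmodule Ω k))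

/-- The inclusion of `W^{k,1}(Ω)` into `L¹(Ω)`. -/
def toL1 : SobolevW1 Ω k →ₗ[ℝ] L1Space Ω := (sobolevSubmodule Ω k).subtype

theorem toL1_injective : Function.Injective (toL1 : SobolevW1 Ω k → L1Space Ω) :=
  Subtype.val_injective

open Classical in
/-- The weak derivative `D^α u ∈ L¹(Ω)` of `u ∈ W^{k,1}(Ω)`, for `|α| ≤ k`
(and zero for a longer `α` if there is no such derivative). -/
def weakDeriv (α : Fin d → ℕ) (u : SobolevW1 Ω k) : L1Space Ω :=
  if h : ∃ v : L1Space Ω, IsWeakDeriv Ω α (toL1 u) v then h.choose else 0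

theorem isWeakDeriv_weakDeriv {α : Fin d → ℕ} (hα : α ∈ multiIndices d k) (u : SobolevW1 Ω k) :
    IsWeakDeriv Ω α (toL1 u) (weakDeriv α u) := by
  have h : ∃ v : L1Space Ω, IsWeakDeriv Ω α (toL1 u) v := u.2 α hα
  rw [weakDeriv, dif_pos h]
  exact h.choose_spec

theorem weakDeriv_eq {α : Fin d → ℕ} (hα : α ∈ multiIndices d k) {u : SobolevW1 Ω k} {v : L1Space Ω}
    (h : IsWeakDeriv Ω α (toL1 u) v) : weakDeriv α u = v :=
  (isWeakDeriv_weakDeriv hα u).unique h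

theorem weakDeriv_zero_index (u : SobolevW1 Ω k) : weakDeriv 0 u = toL1 u :=
  weakDeriv_eq (by simp [mem_multiIndices]) fun φ => by simp [testDeriv_zero]

theorem weakDeriv_add {α : Fin d → ℕ} (hα : α ∈ multiIndices d k) (u v : SobolevW1 Ω k) :
    weakDeriv α (u + v) = weakDeriv α u + weakDeriv α v :=
  weakDeriv_eq hα (by
    rw [map_add]
    exact (isWeakDeriv_weakDeriv hα u).add (isWeakDeriv_weakDeriv hα v))

theorem weakDeriv_smul {α : Fin d → ℕ} (hα : α ∈ multiIndices d k) (c : ℝ) (u : SobolevW1 Ω k) :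
    weakDeriv α (c • u) = c • weakDeriv α u :=
  weakDeriv_eq hα (by
    rw [map_smul]
    exact (isWeakDeriv_weakDeriv hα u).smul c)

/-- The norm `‖u‖ = ∑_{|α| ≤ k} ‖D^α u‖_{L¹(Ω)}` of `W^{k,1}(Ω)`. -/
instance : Norm (SobolevW1 Ω k) where
  norm u := ∑ α ∈ multiIndices d k, ‖weakDeriv α u‖

theorem norm_def (u : SobolevW1 Ω k) : ‖u‖ = ∑ α ∈ multiIndices d k, ‖weakDeriv α u‖ := rfl

theorem normCore : NormedSpace.Core ℝ (SobolevW1 Ω k) where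
  norm_nonneg u := Finset.sum_nonneg fun _ _ => norm_nonneg _
  norm_smul c u := by
    rw [norm_def, norm_def, Finset.mul_sum]
    refine Finset.sum_congr rfl fun α hα => ?_
    rw [weakDeriv_smul hα, norm_smul]
  norm_triangle u v := by
    rw [norm_def, norm_def, norm_def, ← Finset.sum_add_distrib]
    refine Finset.sum_le_sum fun α hα => ?_
    rw [weakDeriv_add hα]
    exact norm_add_le _ _
  norm_eq_zero_iff u := by
    constructor
    · intro h
      rw [norm_def, Finset.sum_eq_zero_iff_of_nonneg fun _ _ => norm_nonneg _] at h
      have h0 := norm_eq_zero.1 (h 0 (by simp [mem_multiIndices]))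
      rw [weakDeriv_zero_index] at h0
      exact toL1_injective (h0.trans (map_zero toL1).symm)
    · rintro rfl
      rw [norm_def]
      refine Finset.sum_eq_zero fun α hα => ?_
      have := weakDeriv_smul hα (0 : ℝ) (0 : SobolevW1 Ω k)
      rw [smul_zero, zero_smul] at this
      rw [this, norm_zero]

instance : NormedAddCommGroup (SobolevW1 Ω k) := NormedAddCommGroup.ofCore normCore

instance : NormedSpace ℝ (SobolevW1 Ω k) := NormedSpace.ofCore normCore

end SobolevW1

end

/-!
The `k`-jet `u ↦ (D^α u)_{|α| ≤ k}` embeds `W^{k,1}(Ω)` isometrically, with closed range, into a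
finite `ℓ¹`-sum of copies of `L¹(Ω)`. By Hahn–Banach the weak topology of `W^{k,1}(Ω)` is the one
induced by the jet, so a family is relatively weakly compact if and only if each of its families of
weak derivatives is, and everything reduces to the Dunford–Pettis theorem in `L¹`.

*Sufficiency.* Truncating a uniformly integrable and tight family in height and support approximates
it, uniformly in `L¹`, by families that are bounded in `L²` of a set of finite measure. By
reflexivity of `L²` these are relatively weakly compact in `L¹`, and Grothendieck's lemma passes
this on to the uniform limit.

*Necessity.* If uniform absolute continuity, measured by a finite measure `ν` equivalent to `μ`,
fails for a relatively weakly compact family, then it fails along a weakly convergent sequence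
`f n`. By the Baire category theorem, applied to the unit ball of `L^∞` with the metric of `L¹(ν)`,
the functionals `g ↦ ∫ ⟪f n, g⟫` vary little in `n` on some ball, and changing the center of that
ball on a set of small measure does not leave it; hence `∫_A ‖f n - f N‖` is small for all `n ≥ N`
and all `A` of small measure.
-/

section WeakCompactness

open Bornology Filter Topology NormedSpace
open scoped Pointwise

variable {𝕜 V W : Type*} [RCLike 𝕜] [NormedAddCommGroup V] [NormedSpace 𝕜 V]
  [NormedAddCommGroup W] [NormedSpace 𝕜 W] {S K : Set V}

/-- A set is relatively weakly compact if its closure in the weak topology `σ(V, V*)` is compact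
in that topology; `toWeakSpace` is the identity from `V` to its copy with the weak topology. -/
def IsRelWeaklyCompact (𝕜 : Type*) [RCLike 𝕜] {V : Type*} [NormedAddCommGroup V]
    [NormedSpace 𝕜 V] (S : Set V) : Prop :=
  IsCompact (closure (toWeakSpace 𝕜 V '' S))

theorem continuous_eval_weakSpace (ℓ : StrongDual 𝕜 V) :
    Continuous fun x : WeakSpace 𝕜 V => ℓ ((toWeakSpace 𝕜 V).symm x) :=
  WeakBilin.eval_continuous (topDualPairing 𝕜 V).flip ℓ

namespace IsRelWeaklyCompact

theorem mono (hK : IsRelWeaklyCompact 𝕜 K) (h : S ⊆ K) : IsRelWeaklyCompact 𝕜 S :=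
  IsCompact.closure_of_subset hK ((Set.image_mono h).trans subset_closure)

theorem image (hS : IsRelWeaklyCompact 𝕜 S) (T : V →L[𝕜] W) :
    IsRelWeaklyCompact 𝕜 (T '' S) := by
  refine (IsCompact.image hS (WeakSpace.map T).continuous).closure_of_subset ?_
  rintro _ ⟨_, ⟨x, hx, rfl⟩, rfl⟩
  exact ⟨toWeakSpace 𝕜 V x, subset_closure ⟨x, hx, rfl⟩, rfl⟩

theorem isBounded (hS : IsRelWeaklyCompact 𝕜 S) : IsBounded S := by
  have pointwise_bounded :
      ∀ ℓ : StrongDual 𝕜 V, ∃ C, ∀ x : S, ‖inclusionInDoubleDual 𝕜 V x ℓ‖ ≤ C := by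
    intro ℓ
    obtain ⟨C, hC⟩ := (IsCompact.image hS (continuous_eval_weakSpace ℓ)).isBounded.exists_norm_le
    exact ⟨C, fun x => hC _ ⟨_, subset_closure ⟨x, x.2, rfl⟩, rfl⟩⟩
  obtain ⟨C, hC⟩ := banach_steinhaus pointwise_bounded
  refine isBounded_iff_forall_norm_le.2 ⟨C, fun x hx => ?_⟩
  rw [← (inclusionInDoubleDualLi 𝕜 (E := V)).norm_map x]
  exact hC ⟨x, hx⟩

end IsRelWeaklyCompact

theorem inclusionInDoubleDualWeak_surjective (H : Type*) [NormedAddCommGroup H]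
    [InnerProductSpace ℝ H] [CompleteSpace H] :
    Function.Surjective (inclusionInDoubleDualWeak ℝ H) := by
  intro ξ
  let ℓ : StrongDual ℝ H := (WeakDual.toStrongDual ξ).comp (innerSL ℝ)
  refine ⟨toWeakSpace ℝ H ((InnerProductSpace.toDual ℝ H).symm ℓ), DFunLike.ext _ _ fun φ => ?_⟩
  obtain ⟨y, rfl⟩ := (InnerProductSpace.toDual ℝ H).surjective φ
  change InnerProductSpace.toDual ℝ H y ((InnerProductSpace.toDual ℝ H).symm ℓ) = _
  rw [InnerProductSpace.toDual_apply_apply, real_inner_comm, InnerProductSpace.toDual_symm_apply]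
  rfl

theorem isRelWeaklyCompact_of_isBounded {H : Type*} [NormedAddCommGroup H]
    [InnerProductSpace ℝ H] [CompleteSpace H] {S : Set H} (hS : IsBounded S) :
    IsRelWeaklyCompact ℝ S := by
  refine isCompact_closure_of_isBounded ℝ H _ ?_ ?_
  · rwa [Set.preimage_image_eq _ (toWeakSpace ℝ H).injective]
  · rw [(inclusionInDoubleDualWeak_surjective H).range_eq]
    exact Set.subset_univ _

theorem closure_image_inclusionInDoubleDualWeak_subset {r : ℝ} (hK : IsRelWeaklyCompact 𝕜 K)
    (hSK : S ⊆ K + Metric.closedBall 0 r) :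
    closure (inclusionInDoubleDualWeak 𝕜 V '' (toWeakSpace 𝕜 V '' S)) ⊆
      Set.range (inclusionInDoubleDualWeak 𝕜 V) +
        WeakDual.toStrongDual ⁻¹' Metric.closedBall 0 r := by
  have hC : IsCompact (inclusionInDoubleDualWeak 𝕜 V '' closure (toWeakSpace 𝕜 V '' K) +
      WeakDual.toStrongDual ⁻¹' Metric.closedBall 0 r) :=
    (IsCompact.image hK (inclusionInDoubleDualWeak 𝕜 V).continuous).add
      (WeakDual.isCompact_closedBall 0 r)
  refine (closure_minimal ?_ hC.isClosed).trans
    (Set.add_subset_add_right (Set.image_subset_range _ _))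
  rintro _ ⟨_, ⟨x, hx, rfl⟩, rfl⟩
  obtain ⟨y, hy, z, hz, rfl⟩ := hSK hx
  refine ⟨_, ⟨_, subset_closure ⟨y, hy, rfl⟩, rfl⟩,
    inclusionInDoubleDualWeak 𝕜 V (toWeakSpace 𝕜 V z), ?_, ?_⟩
  · exact (mem_closedBall_zero_iff (E := StrongDual 𝕜 (StrongDual 𝕜 V))).2
      ((double_dual_bound 𝕜 V z).trans (mem_closedBall_zero_iff.1 hz))
  · simp only [map_add]

-- Weak-* limits of `S` in the bidual are at norm distance `≤ ε` from `V` for every `ε > 0`, hence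
-- lie in `V`, which is norm closed in its bidual.
theorem isRelWeaklyCompact_of_forall_subset_add_closedBall [CompleteSpace V]
    (h : ∀ ε > 0, ∃ K, IsRelWeaklyCompact 𝕜 K ∧ S ⊆ K + Metric.closedBall 0 ε) :
    IsRelWeaklyCompact 𝕜 S := by
  have bounded : IsBounded S := by
    obtain ⟨K, hK, hSK⟩ := h 1 one_pos
    exact (hK.isBounded.add Metric.isBounded_closedBall).subset hSK
  refine isCompact_closure_of_isBounded 𝕜 V _ ?_ fun ξ hξ => ?_
  · rwa [Set.preimage_image_eq _ (toWeakSpace 𝕜 V).injective]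
  have range_closed : IsClosed (Set.range (inclusionInDoubleDualLi 𝕜 (E := V))) :=
    (inclusionInDoubleDualLi 𝕜 (E := V)).isometry.isUniformInducing.isComplete_range.isClosed
  suffices hmem : WeakDual.toStrongDual ξ ∈ Set.range (inclusionInDoubleDualLi 𝕜 (E := V)) by
    obtain ⟨x, hx⟩ := hmem
    exact ⟨toWeakSpace 𝕜 V x, WeakDual.toStrongDual.injective hx⟩
  rw [← range_closed.closure_eq]
  refine (Metric.mem_closure_iff (α := StrongDual 𝕜 (StrongDual 𝕜 V))).2 fun ε hε => ?_
  obtain ⟨K, hK, hSK⟩ := h (ε / 2) (half_pos hε)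
  obtain ⟨_, ⟨x, rfl⟩, η, hη, hxη⟩ := closure_image_inclusionInDoubleDualWeak_subset hK hSK hξ
  refine ⟨_, ⟨(toWeakSpace 𝕜 V).symm x, rfl⟩, ?_⟩
  have hξη : WeakDual.toStrongDual ξ =
      inclusionInDoubleDualLi 𝕜 ((toWeakSpace 𝕜 V).symm x) + WeakDual.toStrongDual η := by
    rw [← hxη, map_add]
    rfl
  have hη' : ‖WeakDual.toStrongDual η‖ ≤ ε / 2 :=
    (mem_closedBall_zero_iff (E := StrongDual 𝕜 (StrongDual 𝕜 V))).1 hη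
  rw [hξη]
  exact (dist_self_add_left (E := StrongDual 𝕜 (StrongDual 𝕜 V)) _ _).trans_lt
    (hη'.trans_lt (half_lt_self hε))

theorem exists_seq_dual_separating (𝕜 V : Type*) [RCLike 𝕜] [NormedAddCommGroup V]
    [NormedSpace 𝕜 V] [SeparableSpace V] :
    ∃ ℓ : ℕ → StrongDual 𝕜 V, ∀ x, (∀ n, ℓ n x = 0) → x = 0 := by
  choose ℓ hℓ hℓx using fun n => exists_dual_vector'' 𝕜 (denseSeq V n)
  refine ⟨ℓ, fun x hx => norm_le_zero_iff.1 (le_of_forall_pos_le_add fun ε hε => ?_)⟩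
  obtain ⟨n, hn⟩ := (denseRange_denseSeq V).exists_dist_lt x (half_pos hε)
  rw [dist_eq_norm] at hn
  have norm_le : ‖denseSeq V n‖ ≤ ‖x - denseSeq V n‖ :=
    calc ‖denseSeq V n‖ = ‖ℓ n (x - denseSeq V n)‖ := by
          rw [map_sub, hx, hℓx, zero_sub, norm_neg, RCLike.norm_ofReal, abs_norm]
      _ ≤ 1 * ‖x - denseSeq V n‖ := (ℓ n).le_of_opNorm_le (hℓ n) _
      _ = ‖x - denseSeq V n‖ := one_mul _
  linarith [norm_le_norm_sub_add x (denseSeq V n)]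

theorem IsRelWeaklyCompact.exists_subseq_tendsto [SeparableSpace V] (hS : IsRelWeaklyCompact 𝕜 S)
    {u : ℕ → V} (hu : ∀ n, u n ∈ S) :
    ∃ x, ∃ φ : ℕ → ℕ, StrictMono φ ∧
      ∀ ℓ : StrongDual 𝕜 V, Tendsto (fun n => ℓ (u (φ n))) atTop (𝓝 (ℓ x)) := by
  obtain ⟨ℓ, hℓ⟩ := exists_seq_dual_separating 𝕜 V
  have : CompactSpace (closure (toWeakSpace 𝕜 V '' S)) := isCompact_iff_compactSpace.mp hS
  have : MetrizableSpace (closure (toWeakSpace 𝕜 V '' S)) :=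
    Metric.PiNatEmbed.TopologicalSpace.MetrizableSpace.of_countable_separating
      (fun n x => ℓ n ((toWeakSpace 𝕜 V).symm x.1))
      (fun n => (continuous_eval_weakSpace (ℓ n)).comp continuous_subtype_val) fun x y hxy => by
        contrapose! hxy
        refine Subtype.ext ((toWeakSpace 𝕜 V).symm.injective (sub_eq_zero.1 (hℓ _ fun n => ?_)))
        rw [map_sub, sub_eq_zero, hxy n]
  obtain ⟨x, φ, hφ, hx⟩ := CompactSpace.tendsto_subseq
    fun n => (⟨_, subset_closure ⟨u n, hu n, rfl⟩⟩ : closure (toWeakSpace 𝕜 V '' S))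
  exact ⟨(toWeakSpace 𝕜 V).symm x, φ, hφ, fun ℓ =>
    (((continuous_eval_weakSpace ℓ).comp continuous_subtype_val).tendsto x).comp hx⟩

theorem isInducing_weakSpace_map (J : V →ₗᵢ[𝕜] W) :
    IsInducing (WeakSpace.map J.toContinuousLinearMap) := by
  refine ⟨le_antisymm (WeakSpace.map J.toContinuousLinearMap).continuous.le_induced ?_⟩
  refine continuous_id_iff_le.1 ?_
  let : TopologicalSpace (WeakSpace 𝕜 V) :=
    .induced (WeakSpace.map J.toContinuousLinearMap) inferInstance
  refine WeakBilin.continuous_of_continuous_eval (topDualPairing 𝕜 V).flip fun ℓ => ?_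
  obtain ⟨L, hL, -⟩ := exists_extension_norm_eq J.toLinearMap.range
    (ℓ ∘L J.equivRange.symm.toContinuousLinearEquiv.toContinuousLinearMap)
  have eval_eq : (fun x : WeakSpace 𝕜 V => ℓ ((toWeakSpace 𝕜 V).symm x)) =
      (fun y : WeakSpace 𝕜 W => L ((toWeakSpace 𝕜 W).symm y)) ∘
        WeakSpace.map J.toContinuousLinearMap := by
    funext x
    refine ((hL (J.equivRange ((toWeakSpace 𝕜 V).symm x))).trans ?_).symm
    exact congrArg ℓ (J.equivRange.symm_apply_apply _)
  exact eval_eq ▸ (continuous_eval_weakSpace L).comp continuous_induced_dom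

theorem isClosedEmbedding_weakSpace_map [CompleteSpace V] (J : V →ₗᵢ[𝕜] W) :
    IsClosedEmbedding (WeakSpace.map J.toContinuousLinearMap) := by
  refine ⟨⟨isInducing_weakSpace_map J, J.injective⟩, ?_⟩
  let : NormedSpace ℝ W := NormedSpace.restrictScalars ℝ 𝕜 W
  have : IsScalarTower ℝ 𝕜 W := RestrictScalars.isScalarTower ℝ 𝕜 W
  have range_convex : Convex ℝ (Set.range J) :=
    (J.toLinearMap.range.restrictScalars ℝ).convex
  have range_closed : IsClosed (Set.range J) :=
    J.isometry.isUniformInducing.isComplete_range.isClosed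
  have := range_convex.toWeakSpace_closure 𝕜
  rw [range_closed.closure_eq] at this
  refine closure_eq_iff_isClosed.1 ?_
  convert this.symm using 2 <;> exact (Set.image_id _).symm

theorem isRelWeaklyCompact_image_iff [CompleteSpace V] (J : V →ₗᵢ[𝕜] W) :
    IsRelWeaklyCompact 𝕜 (J '' S) ↔ IsRelWeaklyCompact 𝕜 S := by
  refine ⟨fun h => ?_, fun h => h.image J.toContinuousLinearMap⟩
  have hJ := isClosedEmbedding_weakSpace_map J
  refine (hJ.isCompact_preimage h).closure_of_subset ?_
  rintro _ ⟨x, hx, rfl⟩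
  exact subset_closure ⟨J x, ⟨x, hx, rfl⟩, rfl⟩

theorem isRelWeaklyCompact_piLp_one_iff {κ : Type*} [Fintype κ] {β : κ → Type*}
    [∀ i, NormedAddCommGroup (β i)] [∀ i, NormedSpace 𝕜 (β i)] {S : Set (PiLp 1 β)} :
    IsRelWeaklyCompact 𝕜 S ↔ ∀ i, IsRelWeaklyCompact 𝕜 ((fun v => v i) '' S) := by
  classical
  refine ⟨fun h i => h.image (PiLp.proj 1 β i), fun h => ?_⟩
  let single (i : κ) : β i →L[𝕜] PiLp 1 β :=
    (PiLp.continuousLinearEquiv 1 𝕜 β).symm.toContinuousLinearMap ∘L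
      ContinuousLinearMap.single 𝕜 β i
  have sum_continuous : Continuous fun w : ∀ i, WeakSpace 𝕜 (β i) =>
      ∑ i, WeakSpace.map (single i) (w i) :=
    continuous_finsetSum _ fun i _ => (WeakSpace.map (single i)).continuous.comp
      (continuous_apply i)
  refine ((isCompact_univ_pi h).image sum_continuous).closure_of_subset ?_
  rintro _ ⟨v, hv, rfl⟩
  refine ⟨fun i => toWeakSpace 𝕜 (β i) (v i),
    fun i _ => subset_closure ⟨v i, ⟨v, hv, rfl⟩, rfl⟩, ?_⟩
  refine (WithLp.ofLp_injective 1 ?_ : ∑ i, single i (v i) = v)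
  rw [WithLp.ofLp_sum]
  exact Finset.univ_sum_single v.ofLp

end WeakCompactness

section DunfordPettisSufficiency

open Filter Topology Bornology
open scoped ENNReal NNReal Pointwise

variable {X E H : Type*} [MeasurableSpace X] {μ : Measure X} [NormedAddCommGroup E]
  [NormedAddCommGroup H] [InnerProductSpace ℝ H] [CompleteSpace H]

theorem isRelWeaklyCompact_ae_norm_le_indicator {s : Set X} (hs : MeasurableSet s) (hμs : μ s ≠ ∞)
    (C : ℝ) :
    IsRelWeaklyCompact ℝ {g : Lp H 1 μ | ∀ᵐ x ∂μ, ‖g x‖ ≤ s.indicator (fun _ => C) x} := by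
  let mulIndicator : Lp H 2 μ →L[ℝ] Lp H 1 μ :=
    (ContinuousLinearMap.lsmul ℝ ℝ).holderL μ 2 2 1 (indicatorConstLp 2 hs hμs 1)
  have one_coe : indicatorConstLp 2 hs hμs (1 : ℝ) =ᵐ[μ] s.indicator fun _ => 1 :=
    indicatorConstLp_coeFn
  let r := C * ‖indicatorConstLp 2 hs hμs (1 : ℝ)‖
  refine ((isRelWeaklyCompact_of_isBounded
    (Metric.isBounded_closedBall (x := 0) (r := r))).image mulIndicator).mono fun g hg => ?_
  have memLp : MemLp g 2 μ := (memLp_indicator_const 2 hs C (Or.inr hμs)).mono'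
    (Lp.stronglyMeasurable g).aestronglyMeasurable hg
  refine ⟨memLp.toLp, mem_closedBall_zero_iff.2 (Lp.norm_le_mul_norm_of_ae_le_mul ?_), Lp.ext ?_⟩
  · filter_upwards [memLp.coeFn_toLp, one_coe, hg] with x h₁ h₂ h₃
    rw [h₁, h₂]
    by_cases hx : x ∈ s <;> simpa [hx] using h₃
  · refine ((ContinuousLinearMap.lsmul ℝ ℝ).coeFn_holder _ _).trans ?_
    filter_upwards [memLp.coeFn_toLp, one_coe, hg] with x h₁ h₂ h₃
    rw [h₁, h₂]
    by_cases hx : x ∈ s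
    · simp [hx]
    · simpa [hx, eq_comm] using h₃

theorem mem_ae_norm_le_indicator_add_closedBall {s : Set X} (hs : MeasurableSet s) {f : Lp E 1 μ}
    {C : ℝ≥0} {ε : ℝ} (hε : 0 ≤ ε) (hfC : eLpNorm ({x | C ≤ ‖f x‖₊}.indicator f) 1 μ ≤ .ofReal ε)
    (hfs : eLpNorm (sᶜ.indicator f) 1 μ ≤ .ofReal ε) :
    f ∈ {g : Lp E 1 μ | ∀ᵐ x ∂μ, ‖g x‖ ≤ s.indicator (fun _ => (C : ℝ)) x} +
      Metric.closedBall 0 (ε + ε) := by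
  have hfm : StronglyMeasurable f := Lp.stronglyMeasurable f
  set B : Set X := {x | C ≤ ‖f x‖₊}
  have hB : MeasurableSet B := measurableSet_le measurable_const hfm.nnnorm.measurable
  have trunc : MemLp ((s ∩ Bᶜ).indicator f) 1 μ := (Lp.memLp f).indicator (hs.inter hB.compl)
  refine ⟨trunc.toLp, ?_, f - trunc.toLp, mem_closedBall_zero_iff.2 ?_, add_sub_cancel _ _⟩
  · filter_upwards [trunc.coeFn_toLp] with x hx
    rw [hx]
    by_cases hxsB : x ∈ s ∩ Bᶜ
    · rw [Set.indicator_of_mem hxsB, Set.indicator_of_mem hxsB.1]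
      have hxB : ¬C ≤ ‖f x‖₊ := hxsB.2
      exact (not_le.1 hxB).le
    · rw [Set.indicator_of_notMem hxsB, norm_zero]
      exact Set.indicator_nonneg (fun _ _ => C.2) x
  · have hae : ∀ᵐ x ∂μ, ‖(f - trunc.toLp : Lp E 1 μ) x‖ₑ ≤
        ‖sᶜ.indicator f x‖ₑ + ‖B.indicator f x‖ₑ := by
      filter_upwards [Lp.coeFn_sub f trunc.toLp, trunc.coeFn_toLp] with x h₁ h₂
      rw [h₁, Pi.sub_apply, h₂]
      by_cases hxs : x ∈ s <;> by_cases hxB : x ∈ B <;> simp [hxs, hxB]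
    refine ENNReal.toReal_le_of_le_ofReal (add_nonneg hε hε) ?_
    rw [ENNReal.ofReal_add hε hε]
    refine le_trans ?_ (add_le_add hfs hfC)
    simp only [eLpNorm_one_eq_lintegral_enorm]
    rw [← lintegral_add_left (hfm.indicator hs.compl).enorm]
    exact lintegral_mono_ae hae

-- Truncating in height and support approximates the family, uniformly in `L¹`, by a bounded subset
-- of `L²` over a set of finite measure.
theorem isRelWeaklyCompact_range_of_uniformIntegrable {ι : Type*} {f : ι → Lp H 1 μ}
    (hf : UniformIntegrable (fun i => ⇑(f i)) 1 μ) (hft : UnifTight (fun i => ⇑(f i)) 1 μ) :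
    IsRelWeaklyCompact ℝ (Set.range f) := by
  refine isRelWeaklyCompact_of_forall_subset_add_closedBall fun ε hε => ?_
  obtain ⟨C, hC⟩ := hf.spec one_ne_zero ENNReal.one_ne_top (half_pos hε)
  obtain ⟨s, hs, hμs, hsf⟩ :=
    hft.exists_measurableSet_indicator (ENNReal.ofReal_pos.2 (half_pos hε)).ne'
  refine ⟨_, isRelWeaklyCompact_ae_norm_le_indicator hs hμs.ne C, ?_⟩
  rintro _ ⟨i, rfl⟩
  have := mem_ae_norm_le_indicator_add_closedBall hs (half_pos hε).le (hC i) (hsf i)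
  rwa [add_halves] at this

end DunfordPettisSufficiency

section UniformAbsoluteContinuity

open Filter Topology
open scoped ENNReal

variable {X E ι : Type*} [MeasurableSpace X] [NormedAddCommGroup E] {μ ν : Measure X}
  {f : ι → X → E}

/-- The indefinite integrals `A ↦ ∫_A ‖f i‖ dμ` are absolutely continuous with respect to `ν`,
uniformly in `i`. Unlike `UnifIntegrable`, smallness of `A` is measured by a measure of its own:
for a finite `ν` equivalent to `μ` this also controls the mass of `f i` at infinity. -/
def UnifAbsCont (f : ι → X → E) (μ ν : Measure X) : Prop :=
  ∀ ⦃ε : ℝ≥0∞⦄, 0 < ε → ∃ δ > 0, ∀ i A, MeasurableSet A → ν A < δ →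
    eLpNorm (A.indicator (f i)) 1 μ ≤ ε

theorem exists_pos_forall_measure_lt_of_absolutelyContinuous [IsFiniteMeasure μ] [SigmaFinite ν]
    (h : μ ≪ ν) {ε : ℝ≥0∞} (hε : 0 < ε) : ∃ δ > 0, ∀ A, ν A < δ → μ A < ε := by
  have : ∫⁻ x, μ.rnDeriv ν x ∂ν ≠ ∞ := by
    rw [Measure.lintegral_rnDeriv h]
    exact measure_ne_top μ _
  obtain ⟨δ, hδ, hA⟩ := exists_pos_setLIntegral_lt_of_measure_lt this hε.ne'
  exact ⟨δ, hδ, fun A hνA => Measure.setLIntegral_rnDeriv h A ▸ hA A hνA⟩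

namespace UnifAbsCont

theorem of_finite [Finite ι] [SigmaFinite ν] (h : μ ≪ ν) (hf : ∀ i, Integrable (f i) μ) :
    UnifAbsCont f μ ν := by
  intro ε hε
  have single (i : ι) : ∃ δ > 0, ∀ A, ν A < δ → μ.withDensity (fun x => ‖f i x‖ₑ) A < ε := by
    have := isFiniteMeasure_withDensity (hf i).hasFiniteIntegral.ne
    exact exists_pos_forall_measure_lt_of_absolutelyContinuous
      ((withDensity_absolutelyContinuous μ _).trans h) hε
  choose δ hδ hδA using single
  obtain ⟨δ₀, hle, hδ₀⟩ :=
    ((eventually_all.2 fun i => Ioc_mem_nhdsGT (hδ i)).and self_mem_nhdsWithin).exists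
  refine ⟨δ₀, hδ₀, fun i A hA hνA => ?_⟩
  rw [eLpNorm_indicator_eq_eLpNorm_restrict hA, eLpNorm_one_eq_lintegral_enorm,
    ← withDensity_apply _ hA]
  exact (hδA i A (hνA.trans_le (hle i).2)).le

theorem unifIntegrable [IsFiniteMeasure ν] [SigmaFinite μ] (hνμ : ν ≪ μ)
    (hf : UnifAbsCont f μ ν) : UnifIntegrable f 1 μ := by
  intro ε hε
  obtain ⟨δ, hδ, hfδ⟩ := hf (ENNReal.ofReal_pos.2 hε)
  obtain ⟨η, hη, hηδ⟩ := exists_pos_forall_measure_lt_of_absolutelyContinuous hνμ hδ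
  obtain ⟨η', -, hη', hη'η⟩ := ENNReal.lt_iff_exists_real_btwn.1 hη
  exact ⟨η', ENNReal.ofReal_pos.1 hη',
    fun i A hA hμA => hfδ i A hA (hηδ A (hμA.trans_lt hη'η))⟩

theorem unifTight [IsFiniteMeasure ν] [SigmaFinite μ] (hf : UnifAbsCont f μ ν) :
    UnifTight f 1 μ := by
  rw [unifTight_iff_ennreal]
  intro ε hε
  obtain ⟨δ, hδ, hfδ⟩ := hf hε
  have tendsto_compl : Tendsto (fun n => ν (spanningSets μ n)ᶜ) atTop (𝓝 0) := by
    have := tendsto_measure_iInter_atTop (μ := ν)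
      (fun n => (measurableSet_spanningSets μ n).compl.nullMeasurableSet)
      (fun m n hmn => Set.compl_subset_compl.2 (monotone_spanningSets μ hmn))
      ⟨0, measure_ne_top _ _⟩
    rwa [← Set.compl_iUnion, iUnion_spanningSets, Set.compl_univ, measure_empty] at this
  obtain ⟨n, hn⟩ := (tendsto_compl.eventually_lt_const hδ).exists
  exact ⟨spanningSets μ n, (measure_spanningSets_lt_top μ n).ne,
    fun i => hfδ i _ (measurableSet_spanningSets μ n).compl hn⟩

end UnifAbsCont

end UniformAbsoluteContinuity

section VitaliHahnSaks

open Filter Topology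
open scoped ENNReal RealInnerProductSpace

variable {X E H : Type*} [MeasurableSpace X] {μ ν : Measure X} [NormedAddCommGroup E]
  [NormedAddCommGroup H] [InnerProductSpace ℝ H]

theorem exists_isOpen_forall_dist_le_of_cauchySeq {B M : Type*} [TopologicalSpace B] [BaireSpace B]
    [Nonempty B] [PseudoMetricSpace M] {T : ℕ → B → M} (hT : ∀ n, Continuous (T n))
    (hcauchy : ∀ b, CauchySeq fun n => T n b) {ε : ℝ} (hε : 0 < ε) :
    ∃ N, ∃ U : Set B, IsOpen U ∧ U.Nonempty ∧ ∀ b ∈ U, ∀ n ≥ N, dist (T n b) (T N b) ≤ ε := by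
  let C : ℕ → Set B := fun N => {b | ∀ n ≥ N, dist (T n b) (T N b) ≤ ε}
  have closed (N : ℕ) : IsClosed (C N) := by
    simp only [C, Set.ofPred_forall]
    exact isClosed_biInter fun n _ => isClosed_le ((hT n).dist (hT N)) continuous_const
  have cover : ⋃ N, C N = Set.univ := Set.eq_univ_of_forall fun b => Set.mem_iUnion.2 <| by
    obtain ⟨N, hN⟩ := Metric.cauchySeq_iff'.1 (hcauchy b) ε hε
    exact ⟨N, fun n hn => (hN n hn).le⟩
  obtain ⟨N, hN⟩ := nonempty_interior_of_iUnion_of_closed closed cover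
  exact ⟨N, interior (C N), isOpen_interior, hN, fun b hb => interior_subset hb⟩

/-- The closed unit ball of `L^∞(ν; E)` for a finite measure `ν`, as a subset of `L¹(ν; E)`. With
the metric of `L¹(ν; E)` it is complete, and changing a function on a set of small measure moves
it only slightly. -/
def linftyUnitBall (E : Type*) [NormedAddCommGroup E] (ν : Measure X) : Set (Lp E 1 ν) :=
  {g | ∀ᵐ x ∂ν, ‖g x‖ ≤ 1}

theorem isClosed_linftyUnitBall : IsClosed (linftyUnitBall E ν) := by
  refine IsSeqClosed.isClosed fun g g₀ hg hlim => ?_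
  obtain ⟨φ, -, hφ⟩ := (tendstoInMeasure_of_tendsto_Lp hlim).exists_seq_tendsto_ae
  filter_upwards [hφ, ae_all_iff.2 hg] with x hx hb
  exact le_of_tendsto' hx.norm fun n => hb _

theorem zero_mem_linftyUnitBall : 0 ∈ linftyUnitBall E ν := by
  filter_upwards [Lp.coeFn_zero E 1 ν] with x hx
  rw [hx]
  simp

open Classical in
theorem exists_mem_linftyUnitBall_ae_eq_piecewise [IsFiniteMeasure ν] {g : Lp E 1 ν}
    (hg : g ∈ linftyUnitBall E ν) {s : X → E} (hs : StronglyMeasurable s) (hs₁ : ∀ x, ‖s x‖ ≤ 1)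
    {A : Set X} (hA : MeasurableSet A) :
    ∃ g' ∈ linftyUnitBall E ν, dist g' g ≤ 2 * ν.real A ∧ g' =ᵐ[ν] A.piecewise s g := by
  have bound : ∀ᵐ x ∂ν, ‖A.piecewise s g x‖ ≤ 1 := by
    filter_upwards [hg] with x hx
    by_cases hxA : x ∈ A <;> simp [hxA, hx, hs₁ x]
  have memLp : MemLp (A.piecewise s g) 1 ν :=
    .of_bound (hs.piecewise hA (Lp.stronglyMeasurable g)).aestronglyMeasurable 1 bound
  refine ⟨memLp.toLp, ?_, ?_, memLp.coeFn_toLp⟩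
  · filter_upwards [memLp.coeFn_toLp, bound] with x h₁ h₂
    rwa [h₁]
  · have hae : ∀ᵐ x ∂ν, ‖(memLp.toLp - g : Lp E 1 ν) x‖ ≤ A.indicator (fun _ => 2) x := by
      filter_upwards [Lp.coeFn_sub memLp.toLp g, memLp.coeFn_toLp, hg] with x h₁ h₂ h₃
      rw [h₁, Pi.sub_apply, h₂]
      by_cases hxA : x ∈ A
      · simpa [hxA] using (norm_sub_le _ _).trans (by linarith [hs₁ x])
      · simp [hxA]
    calc dist memLp.toLp g = ∫ x, ‖(memLp.toLp - g : Lp E 1 ν) x‖ ∂ν := by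
          rw [dist_eq_norm, L1.norm_eq_integral_norm]
      _ ≤ ∫ x, A.indicator (fun _ => (2 : ℝ)) x ∂ν :=
          integral_mono_ae (L1.integrable_coeFn _).norm ((integrable_const _).indicator hA) hae
      _ = 2 * ν.real A := by rw [integral_indicator hA, setIntegral_const, smul_eq_mul, mul_comm]

theorem integrable_inner_of_mem_linftyUnitBall (hμν : μ ≪ ν) {h : X → H} (hh : Integrable h μ)
    {g : Lp H 1 ν} (hg : g ∈ linftyUnitBall H ν) : Integrable (fun x => ⟪h x, g x⟫) μ := by
  refine hh.norm.mono'
    (hh.aestronglyMeasurable.inner (Lp.stronglyMeasurable g).aestronglyMeasurable) ?_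
  filter_upwards [hμν.ae_le hg] with x hx
  exact (norm_inner_le_norm _ _).trans (mul_le_of_le_one_right (norm_nonneg _) hx)

theorem continuous_integral_inner_linftyUnitBall (hμν : μ ≪ ν) {h : X → H} (hh : Integrable h μ) :
    Continuous fun g : linftyUnitBall H ν => ∫ x, ⟪h x, g.1 x⟫ ∂μ := by
  refine continuous_iff_seqContinuous.2 fun g g₀ hg => tendsto_of_subseq_tendsto fun φ hφ => ?_
  have hgφ : Tendsto (fun n => (g (φ n)).1) atTop (𝓝 g₀.1) :=
    (continuous_subtype_val.tendsto _).comp (hg.comp hφ)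
  obtain ⟨ψ, -, hψ⟩ := (tendstoInMeasure_of_tendsto_Lp hgφ).exists_seq_tendsto_ae
  refine ⟨ψ, tendsto_integral_of_dominated_convergence (fun x => ‖h x‖) ?_ hh.norm ?_ ?_⟩
  · exact fun n => (integrable_inner_of_mem_linftyUnitBall hμν hh (g _).2).aestronglyMeasurable
  · intro n
    filter_upwards [hμν.ae_le (g (φ (ψ n))).2] with x hx
    exact (norm_inner_le_norm _ _).trans (mul_le_of_le_one_right (norm_nonneg _) hx)
  · filter_upwards [hμν.ae_le hψ] with x hx
    exact tendsto_const_nhds.inner hx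

-- Test against two competitors that agree with `g₀` off `A` and are `h / ‖h‖` and `0` on `A`.
theorem setIntegral_norm_le_of_forall_integral_inner_le [IsFiniteMeasure ν] (hμν : μ ≪ ν)
    {h : X → H} (hm : StronglyMeasurable h) (hh : Integrable h μ) {g₀ : Lp H 1 ν}
    (hg₀ : g₀ ∈ linftyUnitBall H ν) {r ε : ℝ}
    (hε : ∀ g ∈ linftyUnitBall H ν, dist g g₀ < r → |∫ x, ⟪h x, g x⟫ ∂μ| ≤ ε)
    {A : Set X} (hA : MeasurableSet A) (hνA : 2 * ν.real A < r) :
    ∫ x in A, ‖h x‖ ∂μ ≤ ε + ε := by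
  classical
  obtain ⟨g₁, hg₁, hd₁, hae₁⟩ := exists_mem_linftyUnitBall_ae_eq_piecewise hg₀
    (s := fun x => ‖h x‖⁻¹ • h x) (hm.norm.inv₀.smul hm)
    (fun x => by simpa [norm_smul] using inv_mul_le_one) hA
  obtain ⟨g₂, hg₂, hd₂, hae₂⟩ := exists_mem_linftyUnitBall_ae_eq_piecewise hg₀
    (s := fun _ => 0) stronglyMeasurable_const (fun _ => by simp) hA
  have hae : (fun x => ⟪h x, g₁ x⟫ - ⟪h x, g₂ x⟫) =ᵐ[μ] A.indicator fun x => ‖h x‖ := by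
    filter_upwards [hμν.ae_le hae₁, hμν.ae_le hae₂] with x h₁ h₂
    rw [h₁, h₂]
    by_cases hxA : x ∈ A
    · simp [hxA, real_inner_smul_right, pow_two, ← mul_assoc, inv_mul_mul_self]
    · simp [hxA]
  calc ∫ x in A, ‖h x‖ ∂μ = ∫ x, ⟪h x, g₁ x⟫ - ⟪h x, g₂ x⟫ ∂μ := by
        rw [integral_congr_ae hae, integral_indicator hA]
    _ = ∫ x, ⟪h x, g₁ x⟫ ∂μ - ∫ x, ⟪h x, g₂ x⟫ ∂μ :=
        integral_sub (integrable_inner_of_mem_linftyUnitBall hμν hh hg₁)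
          (integrable_inner_of_mem_linftyUnitBall hμν hh hg₂)
    _ ≤ ε + ε := by
        linarith [(abs_le.1 (hε g₁ hg₁ (hd₁.trans_lt hνA))).2,
          (abs_le.1 (hε g₂ hg₂ (hd₂.trans_lt hνA))).1]

theorem exists_strongDual_eq_integral_inner {g : X → H} (hg : MemLp g ∞ μ) :
    ∃ ℓ : StrongDual ℝ (Lp H 1 μ), ∀ f, ℓ f = ∫ x, ⟪f x, g x⟫ ∂μ := by
  refine ⟨((innerSL ℝ : H →L[ℝ] H →L[ℝ] ℝ).flip).lpPairing μ ∞ 1 hg.toLp, fun f => ?_⟩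
  rw [ContinuousLinearMap.lpPairing_eq_integral]
  refine integral_congr_ae ?_
  filter_upwards [hg.coeFn_toLp] with x hx
  rw [hx]
  rfl

variable [CompleteSpace H]

theorem exists_forall_setIntegral_norm_sub_le_of_cauchySeq [IsFiniteMeasure ν] (hμν : μ ≪ ν)
    {f : ℕ → Lp H 1 μ} (hf : ∀ ℓ : StrongDual ℝ (Lp H 1 μ), CauchySeq fun n => ℓ (f n)) {ε : ℝ}
    (hε : 0 < ε) :
    ∃ N, ∃ r > 0, ∀ n ≥ N, ∀ A, MeasurableSet A → 2 * ν.real A < r →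
      ∫ x in A, ‖(⇑(f n) - ⇑(f N)) x‖ ∂μ ≤ ε := by
  have : CompleteSpace (linftyUnitBall H ν) := isClosed_linftyUnitBall.completeSpace_coe
  have : Nonempty (linftyUnitBall H ν) := ⟨0, zero_mem_linftyUnitBall⟩
  have cauchy (g : linftyUnitBall H ν) : CauchySeq fun n => ∫ x, ⟪f n x, g.1 x⟫ ∂μ := by
    obtain ⟨ℓ, hℓ⟩ := exists_strongDual_eq_integral_inner (μ := μ) (memLp_top_of_bound
      (Lp.stronglyMeasurable g.1).aestronglyMeasurable 1 (hμν.ae_le g.2))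
    simpa only [hℓ] using hf ℓ
  obtain ⟨N, U, hU, ⟨g₀, hg₀⟩, hN⟩ := exists_isOpen_forall_dist_le_of_cauchySeq
    (fun n => continuous_integral_inner_linftyUnitBall hμν (L1.integrable_coeFn (f n))) cauchy
    (half_pos hε)
  obtain ⟨r, hr, hball⟩ := Metric.isOpen_iff.1 hU g₀ hg₀
  refine ⟨N, r, hr, fun n hn A hA hνA => ?_⟩
  have := setIntegral_norm_le_of_forall_integral_inner_le hμν
    ((Lp.stronglyMeasurable (f n)).sub (Lp.stronglyMeasurable (f N)))
    ((L1.integrable_coeFn (f n)).sub (L1.integrable_coeFn (f N))) g₀.2 (r := r) (ε := ε / 2)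
    (fun g hg hgr => ?_) hA hνA
  · rwa [add_halves] at this
  · have := hN ⟨g, hg⟩ (hball hgr) n hn
    rw [Real.dist_eq, ← integral_sub
      (integrable_inner_of_mem_linftyUnitBall hμν (L1.integrable_coeFn (f n)) hg)
      (integrable_inner_of_mem_linftyUnitBall hμν (L1.integrable_coeFn (f N)) hg)] at this
    simpa only [Pi.sub_apply, inner_sub_left] using this

theorem unifAbsCont_of_cauchySeq [IsFiniteMeasure ν] (hμν : μ ≪ ν) {f : ℕ → Lp H 1 μ}
    (hf : ∀ ℓ : StrongDual ℝ (Lp H 1 μ), CauchySeq fun n => ℓ (f n)) :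
    UnifAbsCont (fun n => ⇑(f n)) μ ν := by
  intro ε hε
  obtain ⟨η, -, hη, hηε⟩ := ENNReal.lt_iff_exists_real_btwn.1 (ENNReal.half_pos hε.ne')
  obtain ⟨N, r, hr, tail⟩ :=
    exists_forall_setIntegral_norm_sub_le_of_cauchySeq hμν hf (ENNReal.ofReal_pos.1 hη)
  obtain ⟨δ, hδ, head⟩ := UnifAbsCont.of_finite hμν
    (fun n : Set.Iic N => L1.integrable_coeFn (f n)) (ENNReal.half_pos hε.ne')
  refine ⟨min δ (.ofReal (r / 2)), lt_min hδ (ENNReal.ofReal_pos.2 (half_pos hr)),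
    fun n A hA hνA => ?_⟩
  have hνAδ : ν A < δ := hνA.trans_le (min_le_left _ _)
  rcases le_total n N with hn | hn
  · exact (head ⟨n, hn⟩ A hA hνAδ).trans ENNReal.half_le_self
  have hνAr : 2 * ν.real A < r := by
    have : ν.real A < r / 2 := ENNReal.toReal_lt_of_lt_ofReal (hνA.trans_le (min_le_right _ _))
    linarith
  have hsub : MemLp (⇑(f n) - ⇑(f N)) 1 μ := (Lp.memLp (f n)).sub (Lp.memLp (f N))
  calc eLpNorm (A.indicator (f n)) 1 μ
      = eLpNorm (A.indicator (⇑(f n) - ⇑(f N)) + A.indicator (f N)) 1 μ := by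
        rw [← Set.indicator_add', sub_add_cancel]
    _ ≤ eLpNorm (A.indicator (⇑(f n) - ⇑(f N))) 1 μ + eLpNorm (A.indicator (f N)) 1 μ :=
        eLpNorm_add_le (hsub.indicator hA).1 ((Lp.memLp (f N)).indicator hA).1 le_rfl
    _ ≤ ε / 2 + ε / 2 := by
        refine add_le_add (le_trans ?_ hηε.le) (head ⟨N, Set.mem_Iic.2 le_rfl⟩ A hA hνAδ)
        rw [eLpNorm_indicator_eq_eLpNorm_restrict hA, eLpNorm_one_eq_lintegral_enorm,
          ← ofReal_integral_norm_eq_lintegral_enorm (memLp_one_iff_integrable.1 hsub).restrict]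
        exact ENNReal.ofReal_le_ofReal (tail n hn A hA hνAr)
    _ = ε := ENNReal.add_halves ε

theorem IsRelWeaklyCompact.unifAbsCont [IsSeparable μ] [SeparableSpace H] [IsFiniteMeasure ν]
    (hμν : μ ≪ ν) {ι : Type*} {f : ι → Lp H 1 μ} (hf : IsRelWeaklyCompact ℝ (Set.range f)) :
    UnifAbsCont (fun i => ⇑(f i)) μ ν := by
  by_contra hcon
  simp only [UnifAbsCont] at hcon
  push Not at hcon
  obtain ⟨ε, hε, hbad⟩ := hcon
  choose i A hA hνA hfA using fun n : ℕ => hbad ((n : ℝ≥0∞) + 1)⁻¹ (by simp)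
  have : Fact ((1 : ℝ≥0∞) ≠ ∞) := ⟨ENNReal.one_ne_top⟩
  obtain ⟨f₀, φ, hφ, hlim⟩ :=
    hf.exists_subseq_tendsto (u := fun n => f (i n)) fun n => Set.mem_range_self _
  obtain ⟨δ, hδ, hfδ⟩ := unifAbsCont_of_cauchySeq hμν (fun ℓ => (hlim ℓ).cauchySeq) hε
  obtain ⟨n, hn⟩ := ENNReal.exists_inv_nat_lt hδ.ne'
  refine (hfA (φ n)).not_ge (hfδ n _ (hA _) ((hνA _).trans_le (le_trans ?_ hn.le)))
  rw [ENNReal.inv_le_inv]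
  exact_mod_cast (hφ.id_le n).trans (Nat.le_succ _)

theorem isRelWeaklyCompact_range_iff [SeparableSpace H] [IsSeparable μ]
    [SigmaFinite μ] {ι : Type*} {f : ι → Lp H 1 μ} :
    IsRelWeaklyCompact ℝ (Set.range f) ↔
      UniformIntegrable (fun i => ⇑(f i)) 1 μ ∧ UnifTight (fun i => ⇑(f i)) 1 μ := by
  refine ⟨fun h => ?_, fun h => isRelWeaklyCompact_range_of_uniformIntegrable h.1 h.2⟩
  obtain ⟨C, hC⟩ := h.isBounded.exists_norm_le
  have absCont := h.unifAbsCont (absolutelyContinuous_toFinite μ)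
  refine ⟨⟨fun i => (Lp.stronglyMeasurable _).aestronglyMeasurable,
    absCont.unifIntegrable (toFinite_absolutelyContinuous μ), C.toNNReal, fun i => ?_⟩,
    absCont.unifTight⟩
  rw [← Lp.enorm_def, ← ofReal_norm]
  exact ENNReal.ofReal_le_ofReal (hC _ (Set.mem_range_self i))

end VitaliHahnSaks

section UniformIntegrabilityOfSums

open Filter Topology
open scoped ENNReal

variable {X E ι κ : Type*} [MeasurableSpace X] {μ : Measure X} [NormedAddCommGroup E] [Fintype κ]
  {g : κ → ι → X → E}

theorem eLpNorm_one_indicator_le_ofReal_iff {f : X → E} (hf : Integrable f μ) {A : Set X}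
    (hA : NullMeasurableSet A μ) {ε : ℝ} (hε : 0 ≤ ε) :
    eLpNorm (A.indicator f) 1 μ ≤ .ofReal ε ↔ ∫ x in A, ‖f x‖ ∂μ ≤ ε := by
  rw [eLpNorm_one_eq_lintegral_enorm, ← ENNReal.ofReal_le_ofReal_iff hε,
    ofReal_integral_norm_eq_lintegral_enorm hf.restrict, ← lintegral_indicator₀ hA]
  simp only [enorm_indicator_eq_indicator_enorm]

theorem sum_lt_of_forall_le_div_card_add_one {t : κ → ℝ} {ε : ℝ} (hε : 0 < ε)
    (h : ∀ a, t a ≤ ε / (Fintype.card κ + 1)) : ∑ a, t a < ε := by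
  calc ∑ a, t a ≤ Fintype.card κ * (ε / (Fintype.card κ + 1)) := by
        simpa using Finset.sum_le_sum fun a (_ : a ∈ Finset.univ) => h a
    _ < ε := by
        rw [← mul_div_assoc, div_lt_iff₀ (by positivity)]
        linarith

theorem setIntegral_norm_le_sum (i : ι) (A : Set X) (a : κ) :
    ∫ x in A, ‖g a i x‖ ∂μ ≤ ∑ b, ∫ x in A, ‖g b i x‖ ∂μ :=
  Finset.single_le_sum (f := fun b => ∫ x in A, ‖g b i x‖ ∂μ)
    (fun _ _ => integral_nonneg fun _ => norm_nonneg _) (Finset.mem_univ a)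

theorem forall_unifIntegrable_iff_sum (hg : ∀ a i, Integrable (g a i) μ) :
    (∀ a, UnifIntegrable (g a) 1 μ) ↔ ∀ ε : ℝ, 0 < ε → ∃ δ : ℝ, 0 < δ ∧
      ∀ i A, NullMeasurableSet A μ → μ A < .ofReal δ → ∑ a, ∫ x in A, ‖g a i x‖ ∂μ < ε := by
  refine ⟨fun h ε hε => ?_, fun h a ε hε => ?_⟩
  · have hε' : 0 < ε / (Fintype.card κ + 1) := by positivity
    choose δ hδ hδA using fun a => h a hε'
    obtain ⟨δ₀, hle, hδ₀⟩ :=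
      ((eventually_all.2 fun a => Ioc_mem_nhdsGT (hδ a)).and self_mem_nhdsWithin).exists
    refine ⟨δ₀, hδ₀, fun i A hA hμA => sum_lt_of_forall_le_div_card_add_one hε fun a => ?_⟩
    obtain ⟨B, -, hB, hBA⟩ := hA.exists_measurable_superset_ae_eq
    rw [← setIntegral_congr_set hBA,
      ← eLpNorm_one_indicator_le_ofReal_iff (hg a i) hB.nullMeasurableSet hε'.le]
    refine hδA a i B hB ?_
    rw [measure_congr hBA]
    exact hμA.le.trans (ENNReal.ofReal_le_ofReal (hle a).2)
  · obtain ⟨δ, hδ, hδA⟩ := h ε hε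
    refine ⟨δ / 2, half_pos hδ, fun i A hA hμA => ?_⟩
    rw [eLpNorm_one_indicator_le_ofReal_iff (hg a i) hA.nullMeasurableSet hε.le]
    refine (setIntegral_norm_le_sum i A a).trans (hδA i A hA.nullMeasurableSet ?_).le
    exact hμA.trans_lt ((ENNReal.ofReal_lt_ofReal_iff hδ).2 (half_lt_self hδ))

theorem forall_unifTight_iff_sum (hg : ∀ a i, Integrable (g a i) μ) :
    (∀ a, UnifTight (g a) 1 μ) ↔ ∀ ε : ℝ, 0 < ε → ∃ s, NullMeasurableSet s μ ∧ μ s < ∞ ∧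
      ∀ i, ∑ a, ∫ x in sᶜ, ‖g a i x‖ ∂μ < ε := by
  simp only [unifTight_iff_real]
  refine ⟨fun h ε hε => ?_, fun h a ε hε => ?_⟩
  · have hε' : 0 < ε / (Fintype.card κ + 1) := by positivity
    choose s hμs hs using fun a => h a hε'
    let S : Set X := ⋃ a, toMeasurable μ (s a)
    have hS : MeasurableSet S := .iUnion fun a => measurableSet_toMeasurable μ (s a)
    refine ⟨S, hS.nullMeasurableSet, ?_,
      fun i => sum_lt_of_forall_le_div_card_add_one hε fun a => ?_⟩
    · refine (measure_iUnion_fintype_le _ _).trans_lt (ENNReal.sum_lt_top.2 fun a _ => ?_)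
      rw [measure_toMeasurable]
      exact (hμs a).lt_top
    · rw [← eLpNorm_one_indicator_le_ofReal_iff (hg a i) hS.compl.nullMeasurableSet hε'.le]
      refine le_trans (eLpNorm_mono fun x => ?_) (hs a i)
      have hsub : toMeasurable μ (s a) ⊆ S := Set.subset_iUnion (fun b => toMeasurable μ (s b)) a
      exact norm_indicator_le_of_subset
        (Set.compl_subset_compl.2 ((subset_toMeasurable μ (s a)).trans hsub)) _ _
  · obtain ⟨s, hs, hμs, hsum⟩ := h ε hε
    refine ⟨s, hμs.ne, fun i => ?_⟩
    rw [eLpNorm_one_indicator_le_ofReal_iff (hg a i) hs.compl hε.le]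
    exact (setIntegral_norm_le_sum i sᶜ a).trans (hsum i).le

end UniformIntegrabilityOfSums

namespace SobolevW1

open Filter Topology
open scoped ENNReal

variable {d : ℕ} {Ω : Opens (EuclideanSpace ℝ (Fin d))} {k : ℕ} {F : Set (SobolevW1 Ω k)}

/-- The `k`-jet `u ↦ (D^α u)_{|α| ≤ k}`, an isometry of `W^{k,1}(Ω)` into an `ℓ¹`-sum of copies of
`L¹(Ω)`. -/
noncomputable def jet : SobolevW1 Ω k →ₗᵢ[ℝ] PiLp 1 fun _ : multiIndices d k => L1Space Ω where
  toFun u := WithLp.toLp 1 fun α => weakDeriv α u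
  map_add' u v := PiLp.ext fun α => weakDeriv_add α.2 u v
  map_smul' c u := PiLp.ext fun α => weakDeriv_smul α.2 c u
  norm_map' u := (PiLp.norm_eq_of_L1 _).trans
    (Finset.sum_coe_sort (multiIndices d k) fun α => ‖weakDeriv α u‖)

theorem jet_apply (u : SobolevW1 Ω k) (α : multiIndices d k) : jet u α = weakDeriv α u :=
  rfl

theorem zero_mem_multiIndices : (0 : Fin d → ℕ) ∈ multiIndices d k := by
  simp [mem_multiIndices]

theorem range_jet : Set.range (jet : SobolevW1 Ω k → _) =
    {v | ∀ α : multiIndices d k, IsWeakDeriv Ω α (v ⟨0, zero_mem_multiIndices⟩) (v α)} := by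
  refine Set.Subset.antisymm ?_ fun v hv => ?_
  · rintro _ ⟨u, rfl⟩ α
    simpa only [jet_apply, weakDeriv_zero_index] using isWeakDeriv_weakDeriv α.2 u
  · exact ⟨⟨v ⟨0, zero_mem_multiIndices⟩, fun α hα => ⟨_, hv ⟨α, hα⟩⟩⟩,
      PiLp.ext fun α => weakDeriv_eq α.2 (hv α)⟩

theorem continuous_integral_mul_test (φ : 𝓓(Ω, ℝ)) :
    Continuous fun v : L1Space Ω => ∫ x in Ω, v x * φ x := by
  obtain ⟨C, hC⟩ := φ.continuous.bounded_above_of_compact_support φ.hasCompactSupport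
  obtain ⟨ℓ, hℓ⟩ := exists_strongDual_eq_integral_inner
    (μ := volume.restrict (Ω : Set (EuclideanSpace ℝ (Fin d))))
    (memLp_top_of_bound φ.continuous.aestronglyMeasurable C (.of_forall hC))
  refine ℓ.continuous.congr fun v => (hℓ v).trans ?_
  simp only [RCLike.inner_apply, conj_trivial, mul_comm]

theorem isClosed_range_jet : IsClosed (Set.range (jet : SobolevW1 Ω k → _)) := by
  simp only [range_jet, IsWeakDeriv, Set.ofPred_forall]
  refine isClosed_iInter fun α => isClosed_iInter fun φ => isClosed_eq ?_ ?_
  · exact (continuous_integral_mul_test _).comp (PiLp.continuous_apply 1 _ _)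
  · exact continuous_const.mul
      ((continuous_integral_mul_test φ).comp (PiLp.continuous_apply 1 _ _))

instance : CompleteSpace (SobolevW1 Ω k) :=
  jet.isometry.isUniformInducing.completeSpace isClosed_range_jet.isComplete

theorem isRelWeaklyCompact_iff_forall_weakDeriv :
    IsRelWeaklyCompact ℝ F ↔ ∀ α : multiIndices d k,
      UniformIntegrable (fun f : F => ⇑(weakDeriv α f.1)) 1 (volume.restrict Ω) ∧
        UnifTight (fun f : F => ⇑(weakDeriv α f.1)) 1 (volume.restrict Ω) := by
  rw [← isRelWeaklyCompact_image_iff jet, isRelWeaklyCompact_piLp_one_iff]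
  refine forall_congr' fun α => ?_
  rw [← isRelWeaklyCompact_range_iff, Set.image_image, Set.image_eq_range]
  rfl

theorem exists_pos_norm_le_iff :
    (∃ M : ℝ, 0 < M ∧ ∀ f ∈ F, ‖f‖ ≤ M) ↔
      ∀ α : multiIndices d k, ∃ C : NNReal, ∀ f : F,
        eLpNorm (weakDeriv α f.1) 1 (volume.restrict Ω) ≤ C := by
  simp only [← Lp.enorm_def, enorm_le_coe]
  refine ⟨fun ⟨M, hM, h⟩ α => ⟨⟨M, hM.le⟩, fun f => ?_⟩, fun h => ?_⟩
  · exact (Finset.single_le_sum (f := fun α => ‖weakDeriv α f.1‖) (fun _ _ => norm_nonneg _)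
      α.2).trans (h f f.2)
  · choose C hC using h
    refine ⟨∑ α, C α + 1, by positivity, fun f hf => ?_⟩
    rw [norm_def, ← Finset.sum_coe_sort]
    push_cast
    refine le_trans (Finset.sum_le_sum fun α _ => ?_) (le_add_of_nonneg_right zero_le_one)
    exact_mod_cast hC α ⟨f, hf⟩

theorem sum_multiIndices (u : SobolevW1 Ω k) (A : Set (EuclideanSpace ℝ (Fin d))) :
    ∑ α ∈ multiIndices d k, ∫ x in A, |u.weakDeriv α x| =
    ∑ α : multiIndices d k, ∫ x in A, ‖u.weakDeriv α x‖ :=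
  (Finset.sum_coe_sort (multiIndices d k) fun α => ∫ x in A, |u.weakDeriv α x|).symm

theorem forall_unifIntegrable_weakDeriv_iff :
    (∀ α : multiIndices d k,
      UnifIntegrable (fun f : F => ⇑(weakDeriv α f.1)) 1 (volume.restrict Ω)) ↔
    ∀ ε : ℝ, 0 < ε → ∃ δ : ℝ, 0 < δ ∧ ∀ f ∈ F, ∀ A : Set (EuclideanSpace ℝ (Fin d)), A ⊆ Ω →
      NullMeasurableSet A volume → volume A < .ofReal δ →
      (∑ α ∈ multiIndices d k, ∫ x in A, |f.weakDeriv α x|) < ε := by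
  rw [forall_unifIntegrable_iff_sum fun _ _ => L1.integrable_coeFn _]
  have hΩ := Ω.isOpen.nullMeasurableSet (μ := volume)
  refine forall₂_congr fun ε _ => exists_congr fun δ => and_congr_right fun _ =>
    ⟨fun h f hf A hAΩ hA hδ => ?_, fun h f A hA hδ => ?_⟩
  · have := h ⟨f, hf⟩ A (hA.mono_ac Measure.absolutelyContinuous_restrict)
      ((Measure.restrict_apply_le _ _).trans_lt hδ)
    rwa [Measure.restrict_restrict_of_subset hAΩ, ← sum_multiIndices] at this
  · rw [Measure.restrict_restrict₀ hA, ← sum_multiIndices]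
    rw [Measure.restrict_apply₀ hA] at hδ
    exact h f f.2 _ Set.inter_subset_right ((nullMeasurableSet_restrict hΩ).1 hA) hδ

theorem forall_unifTight_weakDeriv_iff :
    (∀ α : multiIndices d k,
      UnifTight (fun f : F => ⇑(weakDeriv α f.1)) 1 (volume.restrict Ω)) ↔
    ∀ ε : ℝ, 0 < ε → ∃ w : Set (EuclideanSpace ℝ (Fin d)),
      (w ⊆ Ω ∧ NullMeasurableSet w volume ∧ volume w < ∞) ∧ ∀ f ∈ F,
      (∑ α ∈ multiIndices d k,
        ∫ x in (Ω : Set (EuclideanSpace ℝ (Fin d))) \ w, |f.weakDeriv α x|) < ε := by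
  rw [forall_unifTight_iff_sum fun _ _ => L1.integrable_coeFn _]
  have hΩ := Ω.isOpen.nullMeasurableSet (μ := volume)
  refine forall₂_congr fun ε _ => ⟨?_, ?_⟩
  · rintro ⟨s, hs, hμs, h⟩
    refine ⟨s ∩ Ω, ⟨Set.inter_subset_right, (nullMeasurableSet_restrict hΩ).1 hs,
      Measure.restrict_apply₀ hs ▸ hμs⟩, fun f hf => ?_⟩
    have := h ⟨f, hf⟩
    rwa [Measure.restrict_restrict₀ hs.compl, Set.inter_comm, ← Set.sdiff_eq,
      ← Set.sdiff_inter_self_eq_sdiff, ← sum_multiIndices] at this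
  · rintro ⟨w, ⟨-, hw, hμw⟩, h⟩
    have hw' : NullMeasurableSet w (volume.restrict Ω) :=
      hw.mono_ac Measure.absolutelyContinuous_restrict
    refine ⟨w, hw', (Measure.restrict_apply_le _ _).trans_lt hμw, fun f => ?_⟩
    rw [Measure.restrict_restrict₀ hw'.compl, Set.inter_comm, ← Set.sdiff_eq, ← sum_multiIndices]
    exact h f f.2

theorem isRelWeaklyCompact_iff :
    IsRelWeaklyCompact ℝ F ↔
      (∃ M : ℝ, 0 < M ∧ ∀ f ∈ F, ‖f‖ ≤ M) ∧
      (∀ ε : ℝ, 0 < ε → ∃ δ : ℝ, 0 < δ ∧ ∀ f ∈ F,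
        ∀ A : Set (EuclideanSpace ℝ (Fin d)), A ⊆ Ω → NullMeasurableSet A volume →
        volume A < .ofReal δ → (∑ α ∈ multiIndices d k, ∫ x in A, |f.weakDeriv α x|) < ε) ∧
      ∀ ε : ℝ, 0 < ε → ∃ w : Set (EuclideanSpace ℝ (Fin d)),
        (w ⊆ Ω ∧ NullMeasurableSet w volume ∧ volume w < ∞) ∧ ∀ f ∈ F,
        (∑ α ∈ multiIndices d k,
          ∫ x in (Ω : Set (EuclideanSpace ℝ (Fin d))) \ w, |f.weakDeriv α x|) < ε := by
  rw [isRelWeaklyCompact_iff_forall_weakDeriv, exists_pos_norm_le_iff,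
    ← forall_unifIntegrable_weakDeriv_iff, ← forall_unifTight_weakDeriv_iff, ← forall_and,
    ← forall_and]
  exact forall_congr' fun α => ⟨fun ⟨⟨_, hint, hbdd⟩, ht⟩ => ⟨hbdd, hint, ht⟩,
    fun ⟨hbdd, hint, ht⟩ => ⟨⟨fun _ => (Lp.memLp _).1, hint, hbdd⟩, ht⟩⟩

end SobolevW1

theorem theorem1p2 (d k : ℕ) (hd : 1 ≤ d) (Ω : Opens (EuclideanSpace ℝ (Fin d)))
    (hΩ : (Ω : Set (EuclideanSpace ℝ (Fin d))).Nonempty) (F : Set (SobolevW1 Ω k)) :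
    ((∃ M : ℝ, 0 < M ∧ ∀ f ∈ F, ‖f‖ ≤ M) ∧
      (∃ δ : ℝ → ℝ, (∀ ε, 0 < ε → 0 < δ ε) ∧
        ∀ f ∈ F, ∀ ε, 0 < ε → ∀ A : Set (EuclideanSpace ℝ (Fin d)), A ⊆ Ω →
          -- `A` is Lebesgue measurable
          NullMeasurableSet A volume →
          volume A < ENNReal.ofReal (δ ε) →
          (∑ α ∈ multiIndices d k, ∫ x in A, |f.weakDeriv α x|) < ε) ∧
      (∃ ω : ℝ → Set (EuclideanSpace ℝ (Fin d)),
        (∀ ε, 0 < ε → ω ε ⊆ Ω ∧ NullMeasurableSet (ω ε) volume ∧ volume (ω ε) < ⊤) ∧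
        ∀ f ∈ F, ∀ ε, 0 < ε →
          (∑ α ∈ multiIndices d k,
            ∫ x in (Ω : Set (EuclideanSpace ℝ (Fin d))) \ ω ε, |f.weakDeriv α x|) < ε)) ↔
    -- the closure of `F` in the weak topology is weakly compact
    IsCompact (closure (toWeakSpace ℝ (SobolevW1 Ω k) '' F)) := by
  refine Iff.trans ?_ SobolevW1.isRelWeaklyCompact_iff.symm
  refine and_congr_right fun _ => and_congr ⟨?_, fun h => ?_⟩ ⟨?_, fun h => ?_⟩
  · rintro ⟨δ, hδ, h⟩ ε hε
    exact ⟨δ ε, hδ ε hε, fun f hf => h f hf ε hε⟩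
  · choose! δ hδ hδF using h
    exact ⟨δ, hδ, fun f hf ε hε => hδF ε hε f hf⟩
  · rintro ⟨ω, hω, h⟩ ε hε
    exact ⟨ω ε, hω ε hε, fun f hf => h f hf ε hε⟩
  · choose! ω hω hωF using h
    exact ⟨ω, hω, fun f hf ε hε => hωF ε hε f hf⟩
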